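/- **Theorem 3.24.** Let $F$ be a (commutative) hyperfield with an involution $x\mapsto\bar x$ (a bijective multiplicative map of order at most two, fixing $0$ and $1$ and preserving hyperaddition $\boxplus$), let $E$ be a finite set and let $M$ be a matroid on $E$ with dual matroid $M^*$. For $X\in F^E$ write $\operatorname{supp}X=\{e: X(e)\neq 0\}$, and write $X\perp Y$ if $0$ lies in the hypersum of the elements $X(e)\overline{Y(e)}$, $e\in E$. An *$F$-signature* of a matroid $N$ on $E$ is a set $\mathcal S\subseteq F^E\setminus\{0\}$ that is closed under multiplication by nonzero scalars and for which $X\mapsto \operatorname{supp}X$ induces a bijection from $\mathcal S$ modulo nonzero scalars onto the set of circuits of $N$. A *weak $F$-matroid* on $E$ is given by its set of *$F$-circuits*, a set $\mathcal C\subseteq F^E$ such that - (C0) $0\notin\mathcal C$; - (C1) $\alpha X\in\mathcal C$ for all $X\in\mathcal C$ and $\alpha\in F\setminus\{0\}$; - (C2) if $X,Y\in\mathcal C$ and $\operatorname{supp}X\subseteq\operatorname{supp}Y$, then $X=\alpha Y$ for some $\alpha\in F\setminus\{0\}$; - (C3)$'$ if $X,Y\in\mathcal C$ have distinct supports, $\operatorname{supp}X\cup\operatorname{supp}Y$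 does not properly contain a union of two distinct supports of elements of $\mathcal C$, and $X(e)=-Y(e)\neq0$, then there is $Z\in\mathcal C$ with $Z(e)=0$ and $Z(f)\in X(f)\boxplus Y(f)$ for all $f\in E$. Its *underlying matroid* is the matroid on $E$ whose circuits are the supports of the $F$-circuits. Its *$F$-cocircuits* (the $F$-circuits of the dual weak $F$-matroid) are the $Y\in F^E$ such that $\operatorname{supp}Y$ is a cocircuit of the underlying matroid and, for every $F$-circuit $X$ with $\operatorname{supp}X\cap\operatorname{supp}Y=\{e,f\}$, $e\ne f$, $$\frac{\overline{Y(e)}}{\overline{Y(f)}}=-\frac{X(f)}{X(e)} .$$ Let $\mathcal C$ be an $F$-signature of $M$ and let $\mathcal D$ be an $F$-signature of $M^*$. Then $\mathcal C$ and $\mathcal D$ are the set of $F$-circuits and the set of $F$-cocircuits, respectively, of a weak $F$-matroid with underlying matroid $M$ if and only if $X\perp Y$ for all $X\in\mathcal C$ and $Y\in\mathcal D$ with $|\operatorname{supp}X\cap\operatorname{supp}Y|\le 3$. -/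

import Mathlib

namespace HyperMatroid

/-- A (commutative) hyperfield: a commutative multiplicative monoid with absorbing zero in which
`0 ≠ 1` and every nonzero element is invertible (`CommGroupWithZero`), together with a multivalued
addition making it a commutative hypergroup, over which multiplication distributes. -/
class Hyperfield (F : Type*) extends CommGroupWithZero F, Neg F where
  /-- hyperaddition -/
  hadd : F → F → Set F
  hadd_nonempty : ∀ x y, (hadd x y).Nonempty
  hadd_comm : ∀ x y, hadd x y = hadd y x
  hadd_assoc : ∀ x y z, (⋃ t ∈ hadd y z, hadd x t) = ⋃ s ∈ hadd x y, hadd s z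
  zero_hadd : ∀ x, hadd 0 x = {x}
  /-- `-x` is the unique hyperinverse of `x` -/
  zero_mem_hadd_iff : ∀ x y, (0 : F) ∈ hadd x y ↔ y = -x
  /-- reversibility -/
  mem_hadd_iff : ∀ x y z, x ∈ hadd y z ↔ z ∈ hadd x (-y)
  mul_hadd : ∀ a x y, (fun t => a * t) '' hadd x y = hadd (a * x) (a * y)

infixl:65 " ⊞ₕ " => Hyperfield.hadd

section Hypersum

variable {F : Type*} [Hyperfield F]

/-- Hyperaddition of subsets: the union of all `a ⊞ₕ b` with `a ∈ A`, `b ∈ B`. -/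
def setAdd (A B : Set F) : Set F := ⋃ a ∈ A, ⋃ b ∈ B, a ⊞ₕ b

theorem mem_setAdd {A B : Set F} {x : F} :
    x ∈ setAdd A B ↔ ∃ a ∈ A, ∃ b ∈ B, x ∈ a ⊞ₕ b := by
  simp [setAdd]

instance : Std.Commutative (setAdd (F := F)) where
  comm A B := by
    ext x
    simp only [mem_setAdd]
    constructor
    · rintro ⟨a, ha, b, hb, h⟩
      exact ⟨b, hb, a, ha, by rwa [Hyperfield.hadd_comm]⟩
    · rintro ⟨a, ha, b, hb, h⟩
      exact ⟨b, hb, a, ha, by rwa [Hyperfield.hadd_comm]⟩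

theorem hadd_assoc_iff (a b c x : F) :
    (∃ t ∈ b ⊞ₕ c, x ∈ a ⊞ₕ t) ↔ ∃ s ∈ a ⊞ₕ b, x ∈ s ⊞ₕ c := by
  have h := Set.ext_iff.mp (Hyperfield.hadd_assoc a b c) x
  simpa using h

instance : Std.Associative (setAdd (F := F)) where
  assoc A B C := by
    ext x
    simp only [mem_setAdd]
    constructor
    · rintro ⟨s, ⟨a, ha, b, hb, hs⟩, c, hc, hx⟩
      obtain ⟨t, ht, hx'⟩ := (hadd_assoc_iff a b c x).2 ⟨s, hs, hx⟩
      exact ⟨a, ha, t, ⟨b, hb, c, hc, ht⟩, hx'⟩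
    · rintro ⟨a, ha, t, ⟨b, hb, c, hc, ht⟩, hx⟩
      obtain ⟨s, hs, hx'⟩ := (hadd_assoc_iff a b c x).1 ⟨t, ht, hx⟩
      exact ⟨s, ⟨a, ha, b, hb, hs⟩, c, hc, hx'⟩

/-- The hypersum of a finite family; hyperaddition of sets is commutative and associative with
neutral element `{0}`, so no ordering of the family is needed. -/
def hyperSum {ι : Type*} (s : Finset ι) (x : ι → F) : Set F :=
  s.fold setAdd {0} (fun i => {x i})

end Hypersum

/-- An involution of a hyperfield: a monoid homomorphism with zero which preserves hyperaddition
and squares to the identity. -/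
structure Involution (F : Type*) [Hyperfield F] extends F →*₀ F where
  map_hadd' : ∀ x y, toFun '' (x ⊞ₕ y) = toFun x ⊞ₕ toFun y
  involutive' : ∀ x, toFun (toFun x) = x

section Basic

variable {E F : Type*} [Hyperfield F]

/-- `X ⊥ Y`: zero lies in the inner product, the hypersum over `e` of `X e * conj (Y e)`. -/
def Orthogonal [Fintype E] (τ : Involution F) (X Y : E → F) : Prop :=
  (0 : F) ∈ hyperSum Finset.univ (fun e => X e * τ.toMonoidWithZeroHom (Y e))

/-- `A`, `B` form a modular pair in the family `S` of sets: they are distinct members, and their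
union does not properly contain a union of two distinct members of `S`. -/
def IsModularPair (S : Set (Set E)) (A B : Set E) : Prop :=
  A ∈ S ∧ B ∈ S ∧ A ≠ B ∧ ∀ A' ∈ S, ∀ B' ∈ S, A' ≠ B' → ¬ (A' ∪ B' ⊂ A ∪ B)

variable (E F) in
/-- A weak `F`-matroid on `E`, given by its set of `F`-circuits. -/
structure WeakMatroid where
  /-- the set of `F`-circuits -/
  circuits : Set (E → F)
  zero_notMem : (0 : E → F) ∉ circuits
  smul_mem : ∀ X ∈ circuits, ∀ a : F, a ≠ 0 → (fun e => a * X e) ∈ circuits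
  incomparable : ∀ X ∈ circuits, ∀ Y ∈ circuits,
    Function.support X ⊆ Function.support Y → ∃ a : F, a ≠ 0 ∧ X = fun e => a * Y e
  modular_elimination : ∀ X ∈ circuits, ∀ Y ∈ circuits,
    IsModularPair (Function.support '' circuits) (Function.support X) (Function.support Y) →
    ∀ e, X e = -Y e → X e ≠ 0 → ∃ Z ∈ circuits, Z e = 0 ∧ ∀ f, Z f ∈ X f ⊞ₕ Y f

/-- `M` is the underlying matroid of `N`: the matroid on `E` whose circuits are exactly the
supports of the `F`-circuits of `N`. -/
def WeakMatroid.HasUnderlyingMatroid (N : WeakMatroid E F) (M : Matroid E) : Prop :=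
  M.E = Set.univ ∧ ∀ K : Set E, M.IsCircuit K ↔ K ∈ Function.support '' N.circuits

/-- The `F`-cocircuits of a weak `F`-matroid `N`, i.e. the `F`-circuits of the dual weak
`F`-matroid. They are the vectors `Y` supported on a cocircuit `D` of the underlying matroid whose
ratios are those prescribed by the circuits of `N`: if `X` is an `F`-circuit whose support meets
`D` exactly in two elements `e`, `f` (equivalently, its support is the circuit contained in
`A ∪ {e, f}` for some maximal independent subset `A` of the complement of `D`), then
`conj (Y e) / conj (Y f) = - X f / X e`. -/
def WeakMatroid.cocircuits (τ : Involution F) (N : WeakMatroid E F) : Set (E → F) :=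
  {Y | ∃ M : Matroid E, N.HasUnderlyingMatroid M ∧ M✶.IsCircuit (Function.support Y) ∧
    ∀ X ∈ N.circuits, ∀ e f : E, e ≠ f →
      Function.support X ∩ Function.support Y = {e, f} →
      X e * τ.toMonoidWithZeroHom (Y e) = -(X f * τ.toMonoidWithZeroHom (Y f))}

/-- `C` is an `F`-signature of the matroid `M`: it does not contain `0`, is closed under nonzero
scalars, and taking supports is a bijection from the projective classes of `C` (vectors up to
nonzero scalars) onto the circuits of `M`. -/
structure IsSignature (M : Matroid E) (C : Set (E → F)) : Prop where
  zero_notMem : (0 : E → F) ∉ C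
  smul_mem : ∀ X ∈ C, ∀ a : F, a ≠ 0 → (fun e => a * X e) ∈ C
  support_isCircuit : ∀ X ∈ C, M.IsCircuit (Function.support X)
  support_injective : ∀ X ∈ C, ∀ Y ∈ C, Function.support X = Function.support Y →
    ∃ a : F, a ≠ 0 ∧ X = fun e => a * Y e
  support_surjective : ∀ K : Set E, M.IsCircuit K → ∃ X ∈ C, Function.support X = K

end Basic

end HyperMatroid

/-! Weak matroid to orthogonality: a circuit and a cocircuit never share exactly one element, and on
two common elements orthogonality is the ratio condition. If they share `e, f, g`, the circuit comes
from eliminating some `p` between a modular pair meeting the cocircuit in `{e, g}` and `{f, g}`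
(`exists_isModularPair_of_inter_cocircuit_eq_triple`). The two ratio conditions turn the elimination
relation at `g` into three-term orthogonality.

Orthogonality to weak matroid (`modular_elimination_of_orthogonal`): for a modular pair `X`, `Y`,
choose `a` in `Y` only and `b` in `X` only. The union minus `{a, b}` is independent, so each
remaining `f` lies on a cocircuit meeting the union inside `{a, b, f}`. Orthogonality to the
corresponding vector of `D` ties the value at `f` to the values at `a` and `b`, so a vector
supported in the union and matching `Y` at `a` and `X` at `b` has every entry in the hypersum. The
same ratios determine a cocircuit vector up to scalar, which identifies `D`
(`cocircuits_eq_of_orthogonal`). -/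

namespace HyperMatroid

/-! ### Hyperfield arithmetic, short hypersums and orthogonality -/

section Hyperfield

variable {F : Type*} [Hyperfield F]

theorem zero_mem_hadd_neg (x : F) : (0 : F) ∈ x ⊞ₕ -x :=
  (Hyperfield.zero_mem_hadd_iff x (-x)).2 rfl

theorem hneg_neg (x : F) : -(-x) = x := by
  have h := zero_mem_hadd_neg x
  rw [Hyperfield.hadd_comm, Hyperfield.zero_mem_hadd_iff] at h
  exact h.symm

theorem hneg_zero : -(0 : F) = 0 := by
  have h := zero_mem_hadd_neg (0 : F)
  rw [Hyperfield.zero_hadd] at h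
  exact (Set.mem_singleton_iff.1 h).symm

theorem hadd_zero (x : F) : x ⊞ₕ 0 = {x} := by
  rw [Hyperfield.hadd_comm, Hyperfield.zero_hadd]

theorem mul_mem_hadd {a x y z : F} (h : z ∈ x ⊞ₕ y) : a * z ∈ (a * x) ⊞ₕ (a * y) := by
  rw [← Hyperfield.mul_hadd]
  exact ⟨z, h, rfl⟩

theorem mul_mem_hadd_iff {a x y z : F} (ha : a ≠ 0) :
    a * z ∈ (a * x) ⊞ₕ (a * y) ↔ z ∈ x ⊞ₕ y := by
  refine ⟨fun h => ?_, mul_mem_hadd⟩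
  simpa [← mul_assoc, inv_mul_cancel₀ ha] using mul_mem_hadd (a := a⁻¹) h

theorem mul_hneg (a x : F) : a * -x = -(a * x) := by
  have h := mul_mem_hadd (a := a) (zero_mem_hadd_neg x)
  rwa [mul_zero, Hyperfield.zero_mem_hadd_iff] at h

theorem hneg_mul (a x : F) : -a * x = -(a * x) := by
  rw [mul_comm, mul_hneg, mul_comm]

theorem neg_mem_hadd_neg {x y z : F} (h : z ∈ x ⊞ₕ y) : -z ∈ (-x) ⊞ₕ (-y) := by
  have := mul_mem_hadd (a := -1) h
  simpa [hneg_mul] using this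

theorem setAdd_singleton (a b : F) : setAdd {a} {b} = a ⊞ₕ b := by
  ext x; simp [mem_setAdd]

theorem setAdd_zero_left (A : Set F) : setAdd {0} A = A := by
  ext x; simp [mem_setAdd, Hyperfield.zero_hadd]

theorem hyperSum_empty {ι : Type*} (x : ι → F) : hyperSum ∅ x = {0} := rfl

theorem hyperSum_insert {ι : Type*} [DecidableEq ι] {s : Finset ι} {a : ι} (ha : a ∉ s)
    (x : ι → F) : hyperSum (insert a s) x = setAdd {x a} (hyperSum s x) :=
  Finset.fold_insert ha

theorem hyperSum_singleton {ι : Type*} (a : ι) (x : ι → F) : hyperSum {a} x = {x a} := by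
  classical
  rw [← insert_empty_eq, hyperSum_insert (Finset.notMem_empty a), hyperSum_empty,
    setAdd_singleton, hadd_zero]

theorem hyperSum_pair {ι : Type*} [DecidableEq ι] {a b : ι} (hab : a ≠ b) (x : ι → F) :
    hyperSum {a, b} x = x a ⊞ₕ x b := by
  rw [hyperSum_insert (by simpa using hab), hyperSum_singleton, setAdd_singleton]

/-- Terms equal to zero may be dropped from a hypersum. -/
theorem hyperSum_union_eq {ι : Type*} [DecidableEq ι] (s t : Finset ι) (x : ι → F)
    (h : ∀ i ∈ t, i ∉ s → x i = 0) : hyperSum (t ∪ s) x = hyperSum s x := by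
  induction t using Finset.induction_on with
  | empty => simp
  | insert a t ha ih =>
    have ih' := ih fun i hi => h i (Finset.mem_insert_of_mem hi)
    rw [Finset.insert_union]
    by_cases has : a ∈ s
    · rwa [Finset.insert_eq_of_mem (Finset.mem_union_right _ has)]
    · rw [hyperSum_insert (by simp [ha, has]), ih',
        h a (Finset.mem_insert_self _ _) has, setAdd_zero_left]

theorem hyperSum_univ_eq {ι : Type*} [Fintype ι] (s : Finset ι) (x : ι → F)
    (h : ∀ i, i ∉ s → x i = 0) : hyperSum Finset.univ x = hyperSum s x := by
  classical
  rw [← hyperSum_union_eq s Finset.univ x fun i _ => h i]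
  congr 1
  ext; simp

theorem zero_mem_hyperSum_univ_iff_pair {ι : Type*} [Fintype ι] {a b : ι} (hab : a ≠ b)
    (x : ι → F) (h : ∀ i, i ≠ a → i ≠ b → x i = 0) :
    (0 : F) ∈ hyperSum Finset.univ x ↔ x a = -x b := by
  classical
  rw [hyperSum_univ_eq {a, b} x (by simpa using h), hyperSum_pair hab, Hyperfield.hadd_comm,
    Hyperfield.zero_mem_hadd_iff]

theorem zero_mem_hyperSum_univ_iff_triple {ι : Type*} [Fintype ι] {a b c : ι} (hab : a ≠ b)
    (hac : a ≠ c) (hbc : b ≠ c) (x : ι → F) (h : ∀ i, i ≠ a → i ≠ b → i ≠ c → x i = 0) :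
    (0 : F) ∈ hyperSum Finset.univ x ↔ -x c ∈ x a ⊞ₕ x b := by
  classical
  rw [hyperSum_univ_eq {c, a, b} x (fun i hi => by
      simp only [Finset.mem_insert, Finset.mem_singleton, not_or] at hi
      exact h i hi.2.1 hi.2.2 hi.1),
    hyperSum_insert (by simp [hac.symm, hbc.symm]), hyperSum_pair hab]
  simp [mem_setAdd, Hyperfield.zero_mem_hadd_iff]

namespace Involution

variable (τ : Involution F)

theorem apply_apply (x : F) : τ.toMonoidWithZeroHom (τ.toMonoidWithZeroHom x) = x :=
  τ.involutive' x

theorem injective : Function.Injective τ.toMonoidWithZeroHom :=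
  Function.LeftInverse.injective τ.apply_apply

theorem apply_ne_zero {x : F} : τ.toMonoidWithZeroHom x ≠ 0 ↔ x ≠ 0 := by
  rw [Ne, Ne, map_eq_zero_iff _ τ.injective]

end Involution

section Orthogonal

variable {E : Type*} {τ : Involution F} {X Y : E → F}

theorem mul_eq_zero_of_support_inter_subset {S : Set E}
    (h : Function.support X ∩ Function.support Y ⊆ S) {i : E} (hi : i ∉ S) :
    X i * τ.toMonoidWithZeroHom (Y i) = 0 := by
  by_contra h0
  exact hi (h ⟨left_ne_zero_of_mul h0, τ.apply_ne_zero.1 (right_ne_zero_of_mul h0)⟩)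

theorem orthogonal_of_disjoint [Fintype E] (h : Function.support X ∩ Function.support Y = ∅) :
    Orthogonal τ X Y := by
  rw [Orthogonal, hyperSum_univ_eq ∅ _
    fun i _ => mul_eq_zero_of_support_inter_subset h.subset (Set.notMem_empty i)]
  exact Set.mem_singleton 0

theorem orthogonal_iff_pair [Fintype E] {a b : E} (hab : a ≠ b)
    (h : Function.support X ∩ Function.support Y ⊆ {a, b}) :
    Orthogonal τ X Y ↔
      X a * τ.toMonoidWithZeroHom (Y a) = -(X b * τ.toMonoidWithZeroHom (Y b)) :=
  zero_mem_hyperSum_univ_iff_pair hab (fun e => X e * τ.toMonoidWithZeroHom (Y e))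
    fun _ ha hb => mul_eq_zero_of_support_inter_subset h (by simp [ha, hb])

theorem orthogonal_iff_triple [Fintype E] {a b c : E} (hab : a ≠ b) (hac : a ≠ c) (hbc : b ≠ c)
    (h : Function.support X ∩ Function.support Y ⊆ {a, b, c}) :
    Orthogonal τ X Y ↔ -(X c * τ.toMonoidWithZeroHom (Y c)) ∈
      (X a * τ.toMonoidWithZeroHom (Y a)) ⊞ₕ (X b * τ.toMonoidWithZeroHom (Y b)) :=
  zero_mem_hyperSum_univ_iff_triple hab hac hbc (fun e => X e * τ.toMonoidWithZeroHom (Y e))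
    fun _ ha hb hc => mul_eq_zero_of_support_inter_subset h (by simp [ha, hb, hc])

end Orthogonal

end Hyperfield

/-! ### Circuits, cocircuits and modular pairs -/

section Matroid

open Matroid

variable {E : Type*} {M : Matroid E} {C C' K I : Set E} {e f g : E}

theorem isCircuit_eq_of_subset_insert (hI : M.Indep I) (hC : M.IsCircuit C)
    (hC' : M.IsCircuit C') (h : C ⊆ insert e I) (h' : C' ⊆ insert e I) : C = C' :=
  (hC.eq_fundCircuit_of_subset hI h).trans (hC'.eq_fundCircuit_of_subset hI h').symm

theorem spanning_compl_cocircuit_diff (hK : M.IsCocircuit K) (he : e ∈ K) :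
    M.Spanning (M.E \ (K \ {e})) :=
  Coindep.compl_spanning (hK.isCircuit.sdiff_singleton_indep he)

/-- Were `e` missing, the intersection would be the singleton `{f}`, which is impossible. -/
theorem inter_cocircuit_eq_pair (hC : M.IsCircuit C) (hK : M.IsCocircuit K)
    (hf : f ∈ C ∩ K) (h : C ∩ K ⊆ {e, f}) : C ∩ K = {e, f} := by
  refine h.antisymm ?_
  rintro x (rfl | rfl)
  · by_contra hx
    refine hC.inter_isCocircuit_ne_singleton hK (e := f) (Set.Subset.antisymm ?_ (by simpa using hf))
    intro y hy
    rcases h hy with rfl | hyf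
    · exact (hx hy).elim
    · exact hyf
  · exact hf

/-- Any two elements of a cocircuit are cut out of it by a circuit. -/
theorem exists_isCircuit_inter_cocircuit_eq_pair (hK : M.IsCocircuit K) (he : e ∈ K)
    (hf : f ∈ K) (hef : e ≠ f) : ∃ C, M.IsCircuit C ∧ C ∩ K = {e, f} := by
  obtain ⟨B, hB, hBs⟩ := (spanning_compl_cocircuit_diff hK he).exists_isBase_subset
  have hfB : f ∉ B := fun h => (hBs h).2 ⟨hf, hef.symm⟩
  have hC := hB.fundCircuit_isCircuit (hK.subset_ground hf) hfB
  refine ⟨_, hC, inter_cocircuit_eq_pair hC hK ⟨M.mem_fundCircuit f B, hf⟩ ?_⟩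
  rintro x ⟨hx, hxK⟩
  rcases M.fundCircuit_subset_insert f B hx with rfl | hxB
  · simp
  · by_contra hne
    exact (hBs hxB).2 ⟨hxK, fun h => hne (Or.inl h)⟩

/-- A circuit `K` inside this set differs from `A`, since it misses `f`, and `A ∪ K` misses `e`;
this contradicts modularity. -/
theorem indep_union_diff_of_isModularPair {A B : Set E} (hA : M.IsCircuit A) (hB : M.IsCircuit B)
    (h : IsModularPair {C | M.IsCircuit C} A B) (he : e ∈ B) (heA : e ∉ A) (hf : f ∈ A) :
    M.Indep ((A ∪ B) \ {e, f}) := by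
  rw [indep_iff_forall_subset_not_isCircuit
    (Set.sdiff_subset.trans (Set.union_subset hA.subset_ground hB.subset_ground))]
  intro K hKs hK
  refine h.2.2.2 A hA K hK ?_ ⟨Set.union_subset Set.subset_union_left
    (hKs.trans Set.sdiff_subset), fun hs => ?_⟩
  · rintro rfl
    exact (hKs hf).2 (by simp)
  · rcases hs (Or.inr he) with h' | h'
    · exact heA h'
    · exact (hKs h').2 (by simp)

/-- The fundamental circuits of `g` with respect to two bases `I ∪ {p, e}`, `I ∪ {p, f}` form a
modular pair as soon as they are distinct. -/
theorem isModularPair_of_subset_insert {A B J J' : Set E} (hA : M.IsCircuit A) (hB : M.IsCircuit B)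
    (hAB : A ≠ B) (hJ : M.Indep J) (hJ' : M.Indep J')
    (hAJ : A ⊆ insert g J) (hBJ : B ⊆ insert g J')
    (hJJ' : insert g J' ⊆ insert f (insert g J)) (hJ'J : insert g J ⊆ insert e (insert g J')) :
    IsModularPair {C | M.IsCircuit C} A B := by
  -- `A` is the only circuit in `insert g J`, so deleting any of its elements leaves an independent
  -- set.
  have key : ∀ {A J : Set E}, M.IsCircuit A → M.Indep J → A ⊆ insert g J → ∀ u ∈ A,
      M.Indep (insert g J \ {u}) := by
    intro A J hA hJ hAJ u hu
    have hgE : g ∈ M.E := by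
      by_contra hg
      exact hA.not_indep (hJ.subset fun x hx => (hAJ hx).resolve_left
        fun h => hg (h ▸ hA.subset_ground hx))
    rw [indep_iff_forall_subset_not_isCircuit
      (Set.sdiff_subset.trans (Set.insert_subset hgE hJ.subset_ground))]
    intro K hKs hK
    have := isCircuit_eq_of_subset_insert hJ hK hA (hKs.trans Set.sdiff_subset) hAJ
    exact (hKs (this ▸ hu)).2 rfl
  refine ⟨hA, hB, hAB, fun K hK K' hK' hne hss => hne ?_⟩
  obtain ⟨u, hu, huK⟩ := Set.exists_of_ssubset hss
  -- With `u` removed, `A ∪ B` is contained in an independent set plus one element, which leaves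
  -- room for only one circuit.
  have fin : ∀ {x : E} {S : Set E}, M.Indep (S \ {u}) → A ∪ B ⊆ insert x S → K = K' := by
    intro x S hS hABS
    refine isCircuit_eq_of_subset_insert (e := x) hS hK hK' ?_ ?_
    · intro y hy
      exact (hABS (hss.1 (Or.inl hy))).imp_right
        fun h => ⟨h, fun hyu => huK (Or.inl (hyu ▸ hy))⟩
    · intro y hy
      exact (hABS (hss.1 (Or.inr hy))).imp_right
        fun h => ⟨h, fun hyu => huK (Or.inr (hyu ▸ hy))⟩
  rcases hu with hu | hu
  · exact fin (key hA hJ hAJ u hu)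
      (Set.union_subset (hAJ.trans (Set.subset_insert _ _)) (hBJ.trans hJJ'))
  · exact fin (key hB hJ' hBJ u hu)
      (Set.union_subset (hAJ.trans hJ'J) (hBJ.trans (Set.subset_insert _ _)))

/-- A circuit meeting a cocircuit in three elements `e, f, g` arises by elimination from a modular
pair of circuits meeting the cocircuit in `e, g` and in `f, g`. -/
theorem exists_isModularPair_of_inter_cocircuit_eq_triple (hC : M.IsCircuit C)
    (hK : M.IsCocircuit K) (hef : e ≠ f) (heg : e ≠ g) (hfg : f ≠ g) (h : C ∩ K = {e, f, g}) :
    ∃ A B p, M.IsCircuit A ∧ M.IsCircuit B ∧ IsModularPair {C | M.IsCircuit C} A B ∧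
      A ∩ K = {e, g} ∧ B ∩ K = {f, g} ∧ p ∈ A ∧ p ∈ B ∧
      ∀ C', M.IsCircuit C' → C' ⊆ A ∪ B → p ∉ C' → C' = C := by
  have he : e ∈ C ∩ K := by simp [h]
  have hf : f ∈ C ∩ K := by simp [h]
  have hg : g ∈ C ∩ K := by simp [h]
  -- a base containing `C \ {g}` that meets `K` only in `e` and `f`
  obtain ⟨B₀, hB₀, hCB₀, hB₀K⟩ := (hC.sdiff_singleton_indep hg.1).exists_isBase_subset_spanning
    (S := M.E \ (K \ {e, f}))
    ((spanning_compl_cocircuit_diff hK he.2).superset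
      (Set.sdiff_subset_sdiff_right (Set.sdiff_subset_sdiff_right (by simp)))
      Set.sdiff_subset) (by
      rintro x ⟨hx, hxg⟩
      refine ⟨hC.subset_ground hx, fun hxK => hxK.2 ?_⟩
      have : x ∈ C ∩ K := ⟨hx, hxK.1⟩
      rw [h] at this
      simp only [Set.mem_insert_iff, Set.mem_singleton_iff] at this hxg ⊢
      tauto)
  have heB : e ∈ B₀ := hCB₀ ⟨he.1, heg⟩
  have hfB : f ∈ B₀ := hCB₀ ⟨hf.1, hfg⟩
  have hgB : g ∉ B₀ := fun hg' => (hB₀K hg').2 ⟨hg.2, by simp [heg.symm, hfg.symm]⟩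
  have hCsub : C ⊆ insert g B₀ := by
    intro x hx
    by_cases hxg : x = g
    · exact Or.inl hxg
    · exact Or.inr (hCB₀ ⟨hx, hxg⟩)
  set I := B₀ \ {e, f} with hI
  have hIind : M.Indep I := hB₀.indep.subset Set.sdiff_subset
  have hIK : ∀ x ∈ I, x ∉ K := fun x hx hxK => (hB₀K hx.1).2 ⟨hxK, hx.2⟩
  have hB₀I : B₀ = insert f (insert e I) := by
    ext x
    simp only [hI, Set.mem_insert_iff, Set.mem_sdiff, Set.mem_singleton_iff]
    by_cases hxe : x = e <;> by_cases hxf : x = f <;> simp_all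
  have heI : e ∉ I := fun hx => hIK e hx he.2
  have hfI : f ∉ I := fun hx => hIK f hx hf.2
  have hgI : g ∉ I := fun hx => hIK g hx hg.2
  -- a set avoiding `K` does not span any element of `K`
  have hcl : ∀ S ⊆ M.E, Disjoint S K → ∀ x ∈ K, x ∉ M.closure S := by
    intro S _ hSK x hx hxS
    have hxS' : x ∉ S := fun h' => Set.disjoint_left.1 hSK h' hx
    obtain ⟨C', hC's, hC', hxC'⟩ := (mem_closure_iff_exists_isCircuit hxS').1 hxS
    refine hC'.inter_isCocircuit_ne_singleton hK (e := x) (Set.Subset.antisymm ?_ ?_)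
    · rintro y ⟨hy, hyK⟩
      exact (hC's hy).resolve_right fun hyS => Set.disjoint_left.1 hSK hyS hyK
    · simpa using ⟨hxC', hx⟩
  -- If `I` spanned the hyperplane `M.E \ K`, then `insert e I` would be spanning, leaving no room
  -- for `f` in the base `B₀`.
  obtain ⟨p, ⟨hpE, hpK⟩, hpI⟩ : ∃ p ∈ M.E \ K, p ∉ M.closure I := by
    by_contra! hp
    have hs : M.Spanning (insert e I) := by
      have hsp := spanning_compl_cocircuit_diff hK he.2
      rw [spanning_iff_ground_subset_closure (Set.insert_subset (hC.subset_ground he.1)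
        hIind.subset_ground), ← hsp.closure_eq]
      refine M.closure_subset_closure_of_subset_closure ?_
      rintro x ⟨hxE, hx⟩
      by_cases hxe : x = e
      · exact M.mem_closure_of_mem' (Or.inl hxe) hxE
      · exact M.closure_subset_closure (Set.subset_insert e I)
          (hp x ⟨hxE, fun hxK => hx ⟨hxK, hxe⟩⟩)
    have hfcl : f ∈ M.closure (insert e I) := hs.closure_eq ▸ hC.subset_ground hf.1
    have hind := hB₀.indep
    rw [hB₀I] at hind
    rw [(hind.subset (Set.subset_insert _ _)).insert_indep_iff_of_notMem
      (by simp [hef.symm, hfI])] at hind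
    exact hind.2 hfcl
  have hpS : p ∉ I := fun hp => hpI (M.mem_closure_of_mem' hp hpE)
  -- Exchange `y` for `p` in `B₀` and take the circuit that `g` closes. It contains `p`: otherwise
  -- it would be the unique circuit `C` of `insert g B₀`, which contains `y`.
  have side : ∀ x y, B₀ = insert y (insert x I) → x ∈ C ∩ K → y ∈ C ∩ K → x ≠ y → y ≠ g →
      M.Indep (insert p (insert x I)) ∧ ∃ A, M.IsCircuit A ∧ A ∩ K = {x, g} ∧ p ∈ A ∧
        A ⊆ insert g (insert p (insert x I)) := by
    intro x y hB hx hy hxy hyg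
    have hxI : M.Indep (insert x I) := hB₀.indep.subset (hB ▸ Set.subset_insert _ _)
    have hpx : p ∉ M.closure (insert x I) := fun hp => by
      refine hcl (insert p I) (Set.insert_subset hpE hIind.subset_ground) ?_ x hx.2
        (mem_closure_insert hpI hp)
      rw [Set.disjoint_left]
      rintro z (rfl | hz)
      exacts [hpK, hIK z hz]
    have hJ : M.Indep (insert p (insert x I)) := hxI.insert_indep_iff.2 (Or.inl ⟨hpE, hpx⟩)
    refine ⟨hJ, ?_⟩
    have hycl : y ∈ M.closure (insert p (insert x I)) :=
      mem_closure_insert hpx (by rw [← hB, hB₀.closure_eq]; exact hpE)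
    have hgcl : g ∈ M.closure (insert p (insert x I)) := by
      have hsub : M.closure B₀ ⊆ M.closure (insert p (insert x I)) := by
        refine M.closure_subset_closure_of_subset_closure ?_
        rw [hB]
        exact Set.insert_subset hycl ((Set.subset_insert _ _).trans
          (M.subset_closure _ hJ.subset_ground))
      exact hsub (hB₀.closure_eq ▸ hC.subset_ground hg.1)
    have hgJ : g ∉ insert p (insert x I) := by
      rintro (rfl | rfl | hgI')
      exacts [hpK hg.2, hgB (by simp [hB]), hgI hgI']
    obtain ⟨A, hAJ, hA, hgA⟩ := exists_isCircuit_of_mem_closure hgcl hgJ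
    have hAK : A ∩ K = {x, g} := by
      refine inter_cocircuit_eq_pair hA hK ⟨hgA, hg.2⟩ ?_
      rintro z ⟨hz, hzK⟩
      rcases hAJ hz with rfl | rfl | rfl | hzI
      exacts [by simp, (hpK hzK).elim, by simp, (hIK z hzI hzK).elim]
    refine ⟨A, hA, hAK, by_contra fun hpA => ?_, hAJ⟩
    have hAC : A = C := isCircuit_eq_of_subset_insert hB₀.indep hA hC (fun z hz => by
      rw [hB]
      rcases hAJ hz with rfl | rfl | h'
      exacts [Or.inl rfl, (hpA hz).elim, Or.inr (Or.inr h')]) hCsub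
    have : y ∈ A ∩ K := hAC ▸ hy
    rw [hAK] at this
    rcases this with h' | h'
    exacts [hxy h'.symm, hyg h']
  obtain ⟨hJ, A, hA, hAK, hpA, hAJ⟩ := side e f hB₀I he hf hef hfg
  obtain ⟨hJ', B, hB, hBK, hpB, hBJ⟩ :=
    side f e (hB₀I.trans (Set.insert_comm _ _ _)) hf he hef.symm heg
  have hAB : A ≠ B := by
    rintro rfl
    have : e ∈ ({f, g} : Set E) := by rw [← hBK, hAK]; simp
    rcases this with h' | h'
    exacts [hef h', heg h']
  refine ⟨A, B, p, hA, hB, ?_, hAK, hBK, hpA, hpB, fun C' hC' hs hp => ?_⟩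
  · refine isModularPair_of_subset_insert (e := e) (f := f) hA hB hAB hJ hJ' hAJ hBJ ?_ ?_ <;>
    · intro z
      simp only [Set.mem_insert_iff]
      tauto
  · refine isCircuit_eq_of_subset_insert hB₀.indep hC' hC (fun z hz => ?_) hCsub
    rw [hB₀I]
    have hzp : z ≠ p := fun h' => hp (h' ▸ hz)
    have := (hs hz).imp (fun h' => hAJ h') fun h' => hBJ h'
    simp only [Set.mem_insert_iff] at this ⊢
    tauto

end Matroid

end HyperMatroid

namespace HyperMatroid

/-! ### Signatures, modular elimination and cocircuits -/

section Signature

open Matroid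

variable {E F : Type*} [Hyperfield F] {M : Matroid E} {C D : Set (E → F)}

theorem IsSignature.exists_support_eq_apply_eq (hC : IsSignature M C) {K : Set E}
    (hK : M.IsCircuit K) {e : E} (he : e ∈ K) {c : F} (hc : c ≠ 0) :
    ∃ X ∈ C, Function.support X = K ∧ X e = c := by
  obtain ⟨X, hX, rfl⟩ := hC.support_surjective K hK
  have hXe : X e ≠ 0 := he
  have ha : c * (X e)⁻¹ ≠ 0 := mul_ne_zero hc (inv_ne_zero hXe)
  refine ⟨_, hC.smul_mem X hX _ ha, ?_, inv_mul_cancel_right₀ hXe c⟩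
  ext x
  simp [hc, hXe]

theorem IsSignature.image_support (hC : IsSignature M C) :
    Function.support '' C = {K | M.IsCircuit K} := by
  ext K
  constructor
  · rintro ⟨X, hX, rfl⟩
    exact hC.support_isCircuit X hX
  · exact hC.support_surjective K

theorem eq_of_mem_hadd_of_eq_zero_right {x y z : F} (h : z ∈ x ⊞ₕ y) (hy : y = 0) : z = x := by
  rwa [hy, hadd_zero] at h

theorem eq_of_mem_hadd_of_eq_zero_left {x y z : F} (h : z ∈ x ⊞ₕ y) (hx : x = 0) : z = y := by
  rwa [hx, Hyperfield.zero_hadd] at h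

/-- In a weak `F`-matroid, a circuit and a cocircuit with at most three common elements in their
supports are orthogonal. -/
theorem WeakMatroid.orthogonal_of_ncard_le_three [Fintype E] (τ : Involution F)
    (N : WeakMatroid E F) (hN : IsSignature M N.circuits) {X Y : E → F} (hX : X ∈ N.circuits)
    (hY : Y ∈ N.cocircuits τ) (hYM : M.IsCocircuit (Function.support Y))
    (hcard : (Function.support X ∩ Function.support Y).ncard ≤ 3) : Orthogonal τ X Y := by
  obtain ⟨-, -, -, hr⟩ := hY
  have hXM := hN.support_isCircuit X hX
  obtain hn | hn | hn | hn : (Function.support X ∩ Function.support Y).ncard = 0 ∨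
      (Function.support X ∩ Function.support Y).ncard = 1 ∨
      (Function.support X ∩ Function.support Y).ncard = 2 ∨
      (Function.support X ∩ Function.support Y).ncard = 3 := by omega
  · exact orthogonal_of_disjoint ((Set.ncard_eq_zero (Set.toFinite _)).1 hn)
  · obtain ⟨e, he⟩ := Set.ncard_eq_one.1 hn
    exact (hXM.inter_isCocircuit_ne_singleton hYM he).elim
  · obtain ⟨e, f, hef, h⟩ := Set.ncard_eq_two.1 hn
    exact (orthogonal_iff_pair hef h.subset).2 (hr X hX e f hef h)
  · obtain ⟨e, f, g, hef, heg, hfg, h⟩ := Set.ncard_eq_three.1 hn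
    obtain ⟨A, B, p, hA, hB, hmod, hAY, hBY, hpA, hpB, huniq⟩ :=
      exists_isModularPair_of_inter_cocircuit_eq_triple hXM hYM hef heg hfg h
    obtain ⟨X₁, hX₁, rfl⟩ := hN.support_surjective A hA
    have hp0 : -X₁ p ≠ 0 := fun h0 => hpA (by rw [← hneg_neg (X₁ p), h0, hneg_zero])
    -- Scaled so that the entries at `p` cancel.
    obtain ⟨X₂, hX₂, rfl, hp⟩ := hN.exists_support_eq_apply_eq hB hpB hp0
    rw [← hN.image_support] at hmod
    obtain ⟨Z, hZ, hZp, hZmem⟩ := N.modular_elimination X₁ hX₁ X₂ hX₂ hmod p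
      (by rw [hp, hneg_neg]) hpA
    have hZX : Function.support Z = Function.support X := by
      refine huniq _ (hN.support_isCircuit Z hZ) (fun x hx => ?_) (by simpa using hZp)
      by_contra hx'
      simp only [Set.mem_union, Function.mem_support, not_or, not_not] at hx'
      exact hx ((eq_of_mem_hadd_of_eq_zero_left (hZmem x) hx'.1).trans hx'.2)
    obtain ⟨a, ha, rfl⟩ := hN.support_injective X hX Z hZ hZX.symm
    have hmemY : ∀ x ∈ ({e, f, g} : Set E), x ∈ Function.support Y := fun x hx => (h ▸ hx).2
    have he₂ : X₂ e = 0 := by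
      by_contra h0
      have : e ∈ ({f, g} : Set E) := hBY ▸ ⟨h0, hmemY e (by simp)⟩
      simp [hef, heg] at this
    have hf₁ : X₁ f = 0 := by
      by_contra h0
      have : f ∈ ({e, g} : Set E) := hAY ▸ ⟨h0, hmemY f (by simp)⟩
      simp [hef.symm, hfg] at this
    have hZe := eq_of_mem_hadd_of_eq_zero_right (hZmem e) he₂
    have hZf := eq_of_mem_hadd_of_eq_zero_left (hZmem f) hf₁
    -- The ratio conditions rewrite the terms at `e` and `f` as negatives of `X₁ g` and `X₂ g` times
    -- the conjugate of `Y g`, so this is `Z g ∈ X₁ g ⊞ₕ X₂ g`, scaled and negated.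
    have key : -(Z g * τ.toMonoidWithZeroHom (Y g)) ∈
        (Z e * τ.toMonoidWithZeroHom (Y e)) ⊞ₕ (Z f * τ.toMonoidWithZeroHom (Y f)) := by
      rw [hZe, hZf, hr X₁ hX₁ e g heg hAY, hr X₂ hX₂ f g hfg hBY]
      refine neg_mem_hadd_neg ?_
      simp only [mul_comm _ (τ.toMonoidWithZeroHom (Y g))]
      exact mul_mem_hadd (hZmem g)
    rw [orthogonal_iff_triple hef heg hfg h.subset]
    simpa only [mul_assoc, mul_hneg] using mul_mem_hadd (a := a) key

/-- Orthogonality of pairs with at most three common elements implies modular elimination. -/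
theorem modular_elimination_of_orthogonal [Fintype E] (τ : Involution F)
    (hC : IsSignature M C) (hD : IsSignature M✶ D)
    (h : ∀ X ∈ C, ∀ Y ∈ D,
      (Function.support X ∩ Function.support Y).ncard ≤ 3 → Orthogonal τ X Y)
    {X Y : E → F} (hX : X ∈ C) (hY : Y ∈ C)
    (hmod : IsModularPair {K | M.IsCircuit K} (Function.support X) (Function.support Y))
    {e : E} (he : X e = -Y e) (he0 : X e ≠ 0) :
    ∃ Z ∈ C, Z e = 0 ∧ ∀ f, Z f ∈ X f ⊞ₕ Y f := by
  have hXM := hC.support_isCircuit X hX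
  have hYM := hC.support_isCircuit Y hY
  have hYe0 : Y e ≠ 0 := fun h0 => he0 (by rw [he, h0, hneg_zero])
  obtain ⟨a, haY, haX⟩ : ∃ a ∈ Function.support Y, a ∉ Function.support X :=
    Set.not_subset.1 fun hs => hmod.2.2.1 (hYM.eq_of_subset_isCircuit hXM hs).symm
  obtain ⟨b, hbX, hbY⟩ : ∃ b ∈ Function.support X, b ∉ Function.support Y :=
    Set.not_subset.1 fun hs => hmod.2.2.1 (hXM.eq_of_subset_isCircuit hYM hs)
  have hXa : X a = 0 := Function.notMem_support.1 haX
  have hYb : Y b = 0 := Function.notMem_support.1 hbY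
  have hab : a ≠ b := fun h' => haX (h' ▸ hbX)
  have hI := indep_union_diff_of_isModularPair hXM hYM hmod haY haX hbX
  -- Ordinary circuit elimination supplies the support of the desired vector.
  obtain ⟨K, hKs, hK⟩ := hXM.elimination hYM hmod.2.2.1 e
  -- for each `f` other than `a`, `b` a vector of `D` supported on `{f, a, b}` within `X ∪ Y`
  have hV : ∀ f ∈ Function.support X ∪ Function.support Y, a ≠ f → b ≠ f →
      ∃ V : E → F, V f ≠ 0 ∧
        ∀ W ∈ C, Function.support W ⊆ Function.support X ∪ Function.support Y →
          -(W f * τ.toMonoidWithZeroHom (V f)) ∈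
            (W a * τ.toMonoidWithZeroHom (V a)) ⊞ₕ (W b * τ.toMonoidWithZeroHom (V b)) := by
    intro f hf haf hbf
    have hfI : f ∈ (Function.support X ∪ Function.support Y) \ {a, b} :=
      ⟨hf, by simp [haf.symm, hbf.symm]⟩
    obtain ⟨K', hK', hK'I⟩ := hI.exists_isCocircuit_inter_eq_mem hfI
    obtain ⟨V, hVD, rfl⟩ := hD.support_surjective K' hK'
    refine ⟨V, (hK'I.symm.subset rfl).1, fun W hW hWs => ?_⟩
    have hsub : Function.support W ∩ Function.support V ⊆ {a, b, f} := by
      rintro x ⟨hxW, hxV⟩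
      by_cases hxab : x ∈ ({a, b} : Set E)
      · rcases hxab with rfl | rfl <;> simp
      · have : x = f := hK'I.subset ⟨hxV, hWs hxW, hxab⟩
        simp [this]
    refine (orthogonal_iff_triple hab haf hbf hsub).1 (h W hW V hVD ?_)
    refine (Set.ncard_le_ncard hsub (Set.toFinite _)).trans ?_
    exact (Set.ncard_eq_three.2 ⟨a, b, f, hab, haf, hbf, rfl⟩).le
  have hXV : ∀ {f : E} {V : E → F}, -(X f * τ.toMonoidWithZeroHom (V f)) ∈
      (X a * τ.toMonoidWithZeroHom (V a)) ⊞ₕ (X b * τ.toMonoidWithZeroHom (V b)) →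
      -(X f * τ.toMonoidWithZeroHom (V f)) = X b * τ.toMonoidWithZeroHom (V b) :=
    fun h' => eq_of_mem_hadd_of_eq_zero_left h' (by rw [hXa, zero_mul])
  have hYV : ∀ {f : E} {V : E → F}, -(Y f * τ.toMonoidWithZeroHom (V f)) ∈
      (Y a * τ.toMonoidWithZeroHom (V a)) ⊞ₕ (Y b * τ.toMonoidWithZeroHom (V b)) →
      -(Y f * τ.toMonoidWithZeroHom (V f)) = Y a * τ.toMonoidWithZeroHom (V a) :=
    fun h' => eq_of_mem_hadd_of_eq_zero_right h' (by rw [hYb, zero_mul])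
  have hKXY : K ⊆ Function.support X ∪ Function.support Y := hKs.trans Set.sdiff_subset
  have heK : e ∉ K := fun h' => (hKs h').2 rfl
  -- The vector for `f = e` fixes the ratio of the entries at `a` and `b` for every vector of `C`
  -- supported on `K`, as these vanish at `e`.
  obtain ⟨V, hVe, hVW⟩ := hV e (Or.inl he0) (fun h' => haX (h' ▸ he0)) fun h' => hbY (h' ▸ hYe0)
  have hXe := hXV (hVW X hX Set.subset_union_left)
  have hYe := hYV (hVW Y hY Set.subset_union_right)
  have hτe : τ.toMonoidWithZeroHom (V e) ≠ 0 := τ.apply_ne_zero.2 hVe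
  have hτa : τ.toMonoidWithZeroHom (V a) ≠ 0 := by
    intro h0
    rw [h0, mul_zero, ← hneg_mul, ← he] at hYe
    exact mul_ne_zero he0 hτe hYe
  have hWV : ∀ W ∈ C, Function.support W = K →
      W b * τ.toMonoidWithZeroHom (V b) = -(W a * τ.toMonoidWithZeroHom (V a)) := by
    intro W hW hWK
    have hWe : W e = 0 := Function.notMem_support.1 (hWK ▸ heK)
    have := hVW W hW (hWK ▸ hKXY)
    rwa [hWe, zero_mul, hneg_zero, Hyperfield.zero_mem_hadd_iff] at this
  -- If `K` missed `b`, this ratio would force it to miss `a` too, placing a circuit inside an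
  -- independent set.
  have hbK : b ∈ K := by
    obtain ⟨W, hW, hWK⟩ := hC.support_surjective K hK
    by_contra hbK
    have hWb : W b = 0 := Function.notMem_support.1 (hWK ▸ hbK)
    have haK : a ∉ K := by
      rw [← hWK, Function.notMem_support]
      have h0 := hWV W hW hWK
      rw [hWb, zero_mul, ← hneg_mul, eq_comm, mul_eq_zero_iff_right hτa] at h0
      rw [← hneg_neg (W a), h0, hneg_zero]
    refine hK.not_indep (hI.subset fun x hx => ⟨hKXY hx, ?_⟩)
    rintro (rfl | rfl)
    exacts [haK hx, hbK hx]
  obtain ⟨Z, hZ, hZK, hZb⟩ := hC.exists_support_eq_apply_eq hK hbK hbX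
  -- Against `V`, the term of `X` at `b` cancels that of `Y` at `a` because `X e = -Y e`; the terms
  -- of `Z` at `a` and `b` also cancel, and `Z b = X b`.
  have hZa : Z a = Y a := by
    have h0 := hWV Z hZ hZK
    rw [hZb, ← hXe, he, hneg_mul, hYe] at h0
    have h1 := congrArg Neg.neg h0
    rw [hneg_neg, hneg_neg] at h1
    exact (mul_right_cancel₀ hτa h1).symm
  refine ⟨Z, hZ, Function.notMem_support.1 (hZK ▸ heK), fun f => ?_⟩
  by_cases hf : f ∈ Function.support X ∪ Function.support Y
  · by_cases haf : a = f
    · subst haf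
      rw [hZa, hXa, Hyperfield.zero_hadd]
      rfl
    by_cases hbf : b = f
    · subst hbf
      rw [hZb, hYb, hadd_zero]
      rfl
    obtain ⟨V', hVf, hVW'⟩ := hV f hf haf hbf
    have hZf := hVW' Z hZ (hZK ▸ hKXY)
    -- The terms at `b` and `a` become the negated terms of `X` and `Y` at `f`; the common nonzero
    -- factor then cancels.
    rw [hZa, hZb, ← hXV (hVW' X hX Set.subset_union_left),
      ← hYV (hVW' Y hY Set.subset_union_right), Hyperfield.hadd_comm] at hZf
    have hZf' := neg_mem_hadd_neg hZf
    simp only [hneg_neg, mul_comm _ (τ.toMonoidWithZeroHom (V' f))] at hZf'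
    exact (mul_mem_hadd_iff (τ.apply_ne_zero.2 hVf)).1 hZf'
  · simp only [Set.mem_union, Function.mem_support, not_or, not_not] at hf
    have hZf : Z f = 0 := by
      by_contra h0
      rcases hKXY (hZK ▸ h0 : f ∈ K) with h' | h'
      exacts [h' hf.1, h' hf.2]
    rw [hf.1, hf.2, hZf, Hyperfield.zero_hadd]
    rfl

/-- The weak `F`-matroid given by an `F`-signature of a matroid which satisfies modular
elimination. -/
def IsSignature.weakMatroid (hC : IsSignature M C)
    (h : ∀ X ∈ C, ∀ Y ∈ C,
      IsModularPair {K | M.IsCircuit K} (Function.support X) (Function.support Y) →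
      ∀ e, X e = -Y e → X e ≠ 0 → ∃ Z ∈ C, Z e = 0 ∧ ∀ f, Z f ∈ X f ⊞ₕ Y f) :
    WeakMatroid E F where
  circuits := C
  zero_notMem := hC.zero_notMem
  smul_mem := hC.smul_mem
  incomparable X hX Y hY hs := hC.support_injective X hX Y hY
    ((hC.support_isCircuit X hX).eq_of_subset_isCircuit (hC.support_isCircuit Y hY) hs)
  modular_elimination X hX Y hY hmod := h X hX Y hY (hC.image_support ▸ hmod)

/-- Needed because `WeakMatroid.cocircuits` only asserts that some underlying matroid exists. -/
theorem WeakMatroid.HasUnderlyingMatroid.unique {N : WeakMatroid E F} {M' : Matroid E}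
    (h : N.HasUnderlyingMatroid M) (h' : N.HasUnderlyingMatroid M') : M = M' :=
  ext_isCircuit (h.1.trans h'.1.symm) fun K _ => (h.2 K).trans (h'.2 K).symm

/-- An `F`-signature of the dual matroid whose members satisfy the ratio condition with respect to
the circuits of a weak `F`-matroid is its set of cocircuits. -/
theorem WeakMatroid.cocircuits_eq_of_orthogonal [Fintype E] (τ : Involution F)
    {N : WeakMatroid E F} (hNM : N.HasUnderlyingMatroid M) (hD : IsSignature M✶ D)
    (h : ∀ X ∈ N.circuits, ∀ Y ∈ D,
      (Function.support X ∩ Function.support Y).ncard ≤ 3 → Orthogonal τ X Y) :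
    N.cocircuits τ = D := by
  have hratio : ∀ Y ∈ D, ∀ X ∈ N.circuits, ∀ e f : E, e ≠ f →
      Function.support X ∩ Function.support Y = {e, f} →
      X e * τ.toMonoidWithZeroHom (Y e) = -(X f * τ.toMonoidWithZeroHom (Y f)) := by
    intro Y hY X hX e f hef hXY
    refine (orthogonal_iff_pair hef hXY.subset).1 (h X hX Y hY ?_)
    rw [hXY, Set.ncard_pair hef]
    omega
  refine Set.Subset.antisymm ?_ fun Y hY =>
    ⟨M, hNM, hD.support_isCircuit Y hY, hratio Y hY⟩
  rintro Y ⟨M', hM', hYM, hr⟩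
  obtain rfl := hNM.unique hM'
  obtain ⟨e, he⟩ := hYM.nonempty
  -- `Y'` is normalised to agree with `Y` at `e`; circuits cutting the cocircuit in `{e, f}` then
  -- force agreement at every other `f`.
  obtain ⟨Y', hY', hs, hYe⟩ := hD.exists_support_eq_apply_eq hYM he he
  suffices hYY' : Y = Y' from hYY' ▸ hY'
  ext f
  by_cases hf : f ∈ Function.support Y
  · by_cases hef : e = f
    · exact hef ▸ hYe.symm
    obtain ⟨K, hK, hKY⟩ := exists_isCircuit_inter_cocircuit_eq_pair hYM he hf hef
    obtain ⟨X, hX, rfl⟩ := (hNM.2 K).1 hK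
    have h1 := hr X hX e f hef hKY
    have h2 := hratio Y' hY' X hX e f hef (hs ▸ hKY)
    rw [hYe, h1] at h2
    have h3 := congrArg Neg.neg h2
    rw [hneg_neg, hneg_neg] at h3
    have hXf : X f ≠ 0 := (hKY.symm.subset (by simp : f ∈ ({e, f} : Set E))).1
    exact τ.injective (mul_left_cancel₀ hXf h3)
  · have hf' : f ∉ Function.support Y' := hs ▸ hf
    rw [Function.notMem_support.1 hf, Function.notMem_support.1 hf']

end Signature

end HyperMatroid

theorem theorem3p24 {E F : Type*} [Fintype E] [HyperMatroid.Hyperfield F]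
    (τ : HyperMatroid.Involution F)
    (M : Matroid E) (hM : M.E = Set.univ)
    (C D : Set (E → F))
    (hC : HyperMatroid.IsSignature M C) (hD : HyperMatroid.IsSignature M✶ D) :
    (∃ N : HyperMatroid.WeakMatroid E F,
        N.HasUnderlyingMatroid M ∧ N.circuits = C ∧ N.cocircuits τ = D) ↔
      ∀ X ∈ C, ∀ Y ∈ D,
        (Function.support X ∩ Function.support Y).ncard ≤ 3 → HyperMatroid.Orthogonal τ X Y := by
  constructor
  · rintro ⟨N, -, rfl, rfl⟩ X hX Y hY hcard
    exact N.orthogonal_of_ncard_le_three τ hC hX hY (hD.support_isCircuit Y hY) hcard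
  · intro h
    have hNM : (hC.weakMatroid fun X hX Y hY hmod e he he0 =>
        HyperMatroid.modular_elimination_of_orthogonal τ hC hD h hX hY hmod he he0
        ).HasUnderlyingMatroid M :=
      ⟨hM, fun K => (Set.ext_iff.1 hC.image_support K).symm⟩
    exact ⟨_, hNM, rfl, HyperMatroid.WeakMatroid.cocircuits_eq_of_orthogonal τ hNM hD h⟩
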